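/- Let $X_1,X_2,\dots$ be independent, identically distributed non-negative random variables with an absolutely continuous distribution function $F$ and $E(X_1^2)<\infty$; put $\bar F=1-F$. Let $v\ge 1$ be an integer, let $h_1(x_1,\dots,x_v)=\max(x_1,\dots,x_v)-\min(x_1,\dots,x_v)$, let $N=E\,h_1(X_1,\dots,X_v)$, and let $$U_1=\binom{n}{v}^{-1}\sum_{1\le i_1<\dots<i_v\le n}h_1(X_{i_1},\dots,X_{i_v}).$$ For $x\ge 0$ put $$g(x)=x\bigl(F^{v-1}(x)-\bar F^{v-1}(x)\bigr)+(v-1)\int_x^\infty yF^{v-2}(y)\,dF(y)-(v-1)\int_0^x y\bar F^{v-2}(y)\,dF(y),$$ where for $v=1$ the two integral terms are $0$. Then $E(h_1(X_1,\dots,X_v)\mid X_1)=g(X_1)$ almost surely, and, with $\sigma_1^2=\operatorname{Var}(g(X_1))$, as $n\to\infty$ the random variable $\sqrt n\,(U_1-N)$ converges in distribution to a Gaussian random variable with mean $0$ and variance $v^2\sigma_1^2$ (the point mass at $0$ if $v=1$). -/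

import Mathlib

open MeasureTheory ProbabilityTheory Filter

/-- The range kernel `h₁(x) = max x - min x` of a finite nonempty family of reals. It is symmetric,
so the family may be indexed by any finite type. -/
noncomputable def rangeKernel {ι : Type} [Fintype ι] (x : ι → ℝ) : ℝ :=
  (⨆ i, x i) - ⨅ i, x i

/-- The U-statistic of degree `v` with the range kernel, computed from the first `n` terms of `x`:
the average of `max - min` over all `v`-element subsets of the `n` indices. -/
noncomputable def rangeUStat (v n : ℕ) (x : ℕ → ℝ) : ℝ :=
  ((n.choose v : ℕ) : ℝ)⁻¹ *
    ∑ s ∈ (Finset.range n).powersetCard v, rangeKernel (fun i : s => x i)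

/-- With `F` the distribution function of the law `P` and `F̄ = 1 - F`, the function
`x (F(x)^(v-1) - F̄(x)^(v-1)) + (v-1) ∫_x^∞ y F(y)^(v-2) dF(y) - (v-1) ∫_0^x y F̄(y)^(v-2) dF(y)`.
For `v = 1` the exponent `v - 2` is read as `0`, and the factor `v - 1 = 0` removes the
integrals. -/
noncomputable def rangeProjection (P : Measure ℝ) (v : ℕ) (x : ℝ) : ℝ :=
  x * (cdf P x ^ (v - 1) - (1 - cdf P x) ^ (v - 1))
    + ((v : ℝ) - 1) * ∫ y in Set.Ioi x, y * cdf P y ^ (v - 2) ∂P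
    - ((v : ℝ) - 1) * ∫ y in Set.Ioc 0 x, y * (1 - cdf P y) ^ (v - 2) ∂P

/-! The proof is Hoeffding's projection method. With g(x) = E h(x, X₂, …, Xᵥ), write U - N as v
times the mean of the g(Xᵢ) - N, plus the average of a remainder W over all v-subsets. W integrates
to zero over all but any one argument (`kernelProjection_degenerateKernel`), so remainders on
subsets sharing at most one index are orthogonal (`integral_degenerate_mul_eq_zero`). Only O(1/n²)
of the pairs of subsets share more, so √n times the average remainder tends to 0 in L², and the
classical central limit theorem for v·g(Xᵢ) decides the limit (`tendstoInDistribution_uStat`). For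
the range kernel, g is the mean of a maximum minus that of a minimum. The maximum is computed by
induction on the number of variables (`integral_iSup_finCons`), the minimum by reflection. -/

/-! ### Counting subsets and their overlaps -/

open Finset in
/-- Every element of a finite set lies in the same number of its `v`-element subsets. -/
theorem Finset.sum_powersetCard_sum {α : Type*} [DecidableEq α] (s : Finset α) (m : ℕ)
    (a : α → ℝ) :
    ∑ t ∈ s.powersetCard (m + 1), ∑ i ∈ t, a i = ((#s - 1).choose m : ℝ) * ∑ i ∈ s, a i := by
  have h : ∀ t ∈ s.powersetCard (m + 1), ∑ i ∈ t, a i = ∑ i ∈ s, if i ∈ t then a i else 0 := by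
    intro t ht
    rw [← Finset.sum_filter, Finset.filter_mem_eq_inter,
      Finset.inter_eq_right.2 (Finset.mem_powersetCard.1 ht).1]
  rw [Finset.sum_congr rfl h, Finset.sum_comm, Finset.mul_sum]
  refine Finset.sum_congr rfl fun i hi => ?_
  rw [← Finset.sum_filter, Finset.sum_const, nsmul_eq_mul]
  have := Finset.card_filter_powersetCard_subset {i} s (m + 1) (by simpa using hi) (by simp)
  simp only [Finset.singleton_subset_iff, Finset.card_singleton, Nat.add_sub_cancel] at this
  rw [this]

open Finset in
/-- The number of `v`-element subsets of `s` sharing at least two elements with `t`. -/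
theorem Finset.card_filter_powersetCard_one_lt_inter_le {α : Type*} [DecidableEq α]
    (s t : Finset α) (v : ℕ) (ht : t ⊆ s) :
    #{u ∈ s.powersetCard v | 1 < #(t ∩ u)} ≤ (#t).choose 2 * (#s - 2).choose (v - 2) := by
  have hsub : {u ∈ s.powersetCard v | 1 < #(t ∩ u)} ⊆
      (t.powersetCard 2).biUnion fun p => {u ∈ s.powersetCard v | p ⊆ u} := by
    intro u hu
    obtain ⟨hu, hc⟩ := Finset.mem_filter.1 hu
    obtain ⟨p, hp, hp2⟩ := Finset.exists_subset_card_eq (s := t ∩ u) (n := 2) hc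
    refine Finset.mem_biUnion.2 ⟨p, Finset.mem_powersetCard.2
      ⟨hp.trans Finset.inter_subset_left, hp2⟩, Finset.mem_filter.2
      ⟨hu, hp.trans Finset.inter_subset_right⟩⟩
  refine (Finset.card_le_card hsub).trans ?_
  rw [← Finset.card_powersetCard 2 t]
  refine Finset.card_biUnion_le_card_mul _ _ _ fun p hp => ?_
  obtain ⟨hp, hp2⟩ := Finset.mem_powersetCard.1 hp
  by_cases hv : 2 ≤ v
  · rw [Finset.card_filter_powersetCard_subset p s v (hp.trans ht) (hp2 ▸ hv), hp2]
  -- Here `v - 2` truncates, but no `u` with fewer than two elements contains `p`.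
  · rw [Finset.filter_false_of_mem]
    · simp
    · intro u hu hpu
      have := Finset.card_le_card hpu
      have := (Finset.mem_powersetCard.1 hu).2
      omega

theorem Nat.cast_choose_succ_mul (n m : ℕ) :
    ((n.choose (m + 1) : ℕ) : ℝ) * (m + 1) = n * ((n - 1).choose m : ℕ) := by
  cases n with
  | zero => simp
  | succ n => exact_mod_cast (Nat.add_one_mul_choose_eq n m).symm

/-- For `v = k + 2`, absorbing factors twice turns the ratio of binomials into (k+2)(k+1)/(n(n-1)),
so the whole is a constant over n - 1. This is the rate at which the remainder's second moment,
scaled by n, vanishes. -/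
theorem tendsto_mul_choose_two_mul_choose_div_choose (v : ℕ) :
    Tendsto (fun n : ℕ => (n : ℝ) *
      ((v.choose 2 * (n - 2).choose (v - 2) : ℕ) / (n.choose v : ℕ))) atTop (nhds 0) := by
  obtain hv | ⟨k, rfl⟩ : v < 2 ∨ ∃ k, v = k + 2 :=
    (lt_or_ge v 2).imp_right fun h => ⟨v - 2, by omega⟩
  · simp [Nat.choose_eq_zero_of_lt hv]
  have h : (fun n : ℕ => ((k + 2).choose 2 : ℝ) * ((k + 2) * (k + 1)) / ((n : ℝ) - 1)) =ᶠ[atTop]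
      fun n : ℕ => (n : ℝ) *
        (((k + 2).choose 2 * (n - 2).choose (k + 2 - 2) : ℕ) / (n.choose (k + 2) : ℕ)) := by
    filter_upwards [eventually_ge_atTop (k + 2)] with n hn
    have h1 := Nat.cast_choose_succ_mul n (k + 1)
    have h2 := Nat.cast_choose_succ_mul (n - 1) k
    have hc : ((n.choose (k + 2) : ℕ) : ℝ) ≠ 0 :=
      Nat.cast_ne_zero.2 (Nat.choose_pos hn).ne'
    have hn1 : (n : ℝ) - 1 ≠ 0 := by
      have : (2 : ℝ) ≤ n := by exact_mod_cast (by omega : 2 ≤ n)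
      linarith
    rw [Nat.cast_sub (by omega), Nat.sub_sub] at h2
    push_cast at h1 h2
    rw [div_eq_iff hn1, Nat.cast_mul, Nat.add_sub_cancel]
    field_simp
    linear_combination ((k + 2).choose 2 : ℝ) * ((k + 1) * h1 + n * h2)
  refine Tendsto.congr' h ?_
  exact Tendsto.const_div_atTop (tendsto_atTop_add_const_right _ _ tendsto_natCast_atTop_atTop) _

/-! ### Second moments and orthogonality -/

open Finset in
/-- If random variables indexed by `v`-element sets are bounded in `L²` and uncorrelated whenever
the indices share at most one element, their sum has few correlated pairs. -/
theorem integral_sq_sum_powersetCard_le {Ω : Type*} [MeasurableSpace Ω] {μ : Measure Ω}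
    {W : Finset ℕ → Ω → ℝ} {v : ℕ} {C : ℝ}
    (hW : ∀ s : Finset ℕ, #s = v → MemLp (W s) 2 μ)
    (hC : ∀ s : Finset ℕ, #s = v → ∫ ω, W s ω ^ 2 ∂μ ≤ C)
    (hW0 : ∀ s t : Finset ℕ, #s = v → #t = v → #(s ∩ t) ≤ 1 → ∫ ω, W s ω * W t ω ∂μ = 0)
    (n : ℕ) :
    ∫ ω, (∑ s ∈ (range n).powersetCard v, W s ω) ^ 2 ∂μ ≤
      n.choose v * ((v.choose 2 * (n - 2).choose (v - 2) : ℕ) * C) := by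
  have hcard {s : Finset ℕ} (hs : s ∈ (range n).powersetCard v) : #s = v :=
    (mem_powersetCard.1 hs).2
  have hint {s t : Finset ℕ} (hs : #s = v) (ht : #t = v) :
      Integrable (fun ω => W s ω * W t ω) μ := (hW s hs).integrable_mul (hW t ht)
  have hle {s t : Finset ℕ} (hs : #s = v) (ht : #t = v) : ∫ ω, W s ω * W t ω ∂μ ≤ C := by
    have h : ∫ ω, W s ω * W t ω ∂μ ≤ ∫ ω, (W s ω ^ 2 + W t ω ^ 2) / 2 ∂μ := by
      refine integral_mono (hint hs ht)
        (((hW s hs).integrable_sq.add (hW t ht).integrable_sq).div_const 2) fun ω => ?_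
      have := two_mul_le_add_sq (W s ω) (W t ω)
      dsimp only
      linarith
    rw [integral_div, integral_add (hW s hs).integrable_sq (hW t ht).integrable_sq] at h
    linarith [hC s hs, hC t ht]
  simp_rw [pow_two, sum_mul_sum]
  rw [integral_finsetSum _ fun s hs => integrable_finsetSum _ fun t ht =>
    hint (hcard hs) (hcard ht)]
  have hn : #((range n).powersetCard v) = n.choose v := by rw [card_powersetCard, card_range]
  rw [← hn, ← nsmul_eq_mul]
  refine sum_le_card_nsmul _ _ _ fun s hs => ?_
  rw [integral_finsetSum _ fun t ht => hint (hcard hs) (hcard ht)]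
  rw [← sum_filter_add_sum_filter_not _ (fun t => 1 < #(s ∩ t)),
    sum_eq_zero (s := {t ∈ (range n).powersetCard v | ¬ 1 < #(s ∩ t)}), add_zero]
  · have hC0 : 0 ≤ C :=
      (integral_nonneg fun ω => sq_nonneg (W s ω)).trans (hC s (hcard hs))
    refine (sum_le_card_nsmul _ _ C fun t ht =>
      hle (hcard hs) (hcard (mem_filter.1 ht).1)).trans ?_
    rw [nsmul_eq_mul]
    refine mul_le_mul_of_nonneg_right (Nat.cast_le.2 ?_) hC0
    have := card_filter_powersetCard_one_lt_inter_le (range n) s v (mem_powersetCard.1 hs).1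
    rwa [hcard hs, card_range] at this
  · intro t ht
    obtain ⟨ht, h1⟩ := mem_filter.1 ht
    exact hW0 s t (hcard hs) (hcard ht) (not_lt.1 h1)

/-- If `B` is independent of `Y`, and a function of `(Y, B)` has zero mean in `B` for almost every
value of `Y`, then it is orthogonal to the functions of `Y`. -/
theorem ProbabilityTheory.IndepFun.integral_mul_eq_zero {Ω α β : Type*} [MeasurableSpace Ω]
    [MeasurableSpace α] [MeasurableSpace β] {μ : Measure Ω} [IsProbabilityMeasure μ]
    {Y : Ω → α} {B : Ω → β} (hYB : IndepFun Y B μ) (hY : Measurable Y) (hB : Measurable B)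
    {φ : α × β → ℝ} {ψ : α → ℝ} (hφ : Measurable φ) (hψ : Measurable ψ)
    (hint : Integrable (fun ω => φ (Y ω, B ω) * ψ (Y ω)) μ)
    (h0 : ∀ᵐ y ∂μ.map Y, ∫ b, φ (y, b) ∂μ.map B = 0) :
    ∫ ω, φ (Y ω, B ω) * ψ (Y ω) ∂μ = 0 := by
  have := Measure.isProbabilityMeasure_map (μ := μ) hB.aemeasurable
  have := Measure.isProbabilityMeasure_map (μ := μ) hY.aemeasurable
  have hm : Measurable fun p : α × β => φ p * ψ p.1 := hφ.mul (hψ.comp measurable_fst)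
  have hprod := (indepFun_iff_map_prod_eq_prod_map_map hY.aemeasurable hB.aemeasurable).1 hYB
  have hYBm : AEMeasurable (fun ω => (Y ω, B ω)) μ := (hY.prodMk hB).aemeasurable
  rw [← integral_map (f := fun p : α × β => φ p * ψ p.1) hYBm hm.aestronglyMeasurable, hprod,
    integral_prod]
  · refine integral_eq_zero_of_ae ?_
    filter_upwards [h0] with y hy
    simp only [integral_mul_const, hy, zero_mul, Pi.zero_apply]
  · rw [← hprod]
    exact (integrable_map_measure hm.aestronglyMeasurable hYBm).2 hint

theorem Measurable.finCons {α : Type*} [MeasurableSpace α] {m : ℕ} {f : α → ℝ}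
    {g : α → Fin m → ℝ} (hf : Measurable f) (hg : Measurable g) :
    Measurable fun a => (Fin.cons (f a) (g a) : Fin (m + 1) → ℝ) := by
  refine measurable_pi_lambda _ fun k => ?_
  cases k using Fin.cases with
  | zero => simpa only [Fin.cons_zero] using hf
  | succ j => simpa only [Fin.cons_succ] using! (measurable_pi_apply j).comp hg

/-! ### Independent, identically distributed sequences -/

section IID

variable {Ω : Type*} [MeasurableSpace Ω] {μ : Measure Ω} {X : ℕ → Ω → ℝ}

theorem map_comp_eq_pi (hmeas : ∀ i, Measurable (X i)) (hindep : iIndepFun X μ)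
    (hident : ∀ i, IdentDistrib (X i) (X 0) μ μ) {ι : Type*} [Fintype ι] {e : ι → ℕ}
    (he : Function.Injective e) :
    μ.map (fun ω k => X (e k) ω) = Measure.pi fun _ : ι => μ.map (X 0) := by
  rw [(hindep.precomp he).map_fun_eq_pi_map fun k => (hmeas (e k)).aemeasurable]
  simp_rw [(hident _).map_eq]

theorem indepFun_comp_comp (hmeas : ∀ i, Measurable (X i)) (hindep : iIndepFun X μ)
    {ι κ : Type*} [Fintype ι] [Fintype κ] {e : ι → ℕ} {f : κ → ℕ} (hef : ∀ j k, e j ≠ f k) :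
    IndepFun (fun ω j => X (e j) ω) (fun ω k => X (f k) ω) μ := by
  classical
  have h := hindep.indepFun_finset (Finset.univ.image e) (Finset.univ.image f) (by
    rw [Finset.disjoint_left]
    intro a ha hb
    obtain ⟨j, -, rfl⟩ := Finset.mem_image.1 ha
    obtain ⟨k, -, hk⟩ := Finset.mem_image.1 hb
    exact hef j k hk.symm) hmeas
  exact h.comp
    (φ := fun x j => x ⟨e j, Finset.mem_image_of_mem e (Finset.mem_univ j)⟩)
    (ψ := fun x k => x ⟨f k, Finset.mem_image_of_mem f (Finset.mem_univ k)⟩)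
    (measurable_pi_lambda _ fun _ => measurable_pi_apply _)
    (measurable_pi_lambda _ fun _ => measurable_pi_apply _)

/-- A degenerate kernel evaluated along two index tuples sharing at most the first entry of one of
them gives uncorrelated variables. -/
theorem integral_degenerate_mul_eq_zero [IsProbabilityMeasure μ]
    (hmeas : ∀ i, Measurable (X i)) (hindep : iIndepFun X μ)
    (hident : ∀ i, IdentDistrib (X i) (X 0) μ μ) {m : ℕ} {W : (Fin (m + 1) → ℝ) → ℝ}
    (hW : Measurable W) (hW2 : MemLp W 2 (Measure.pi fun _ => μ.map (X 0)))
    (hW0 : ∀ᵐ x ∂μ.map (X 0),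
      ∫ z : Fin m → ℝ, W (Fin.cons x z) ∂Measure.pi (fun _ => μ.map (X 0)) = 0)
    {e f : Fin (m + 1) → ℕ} (he : Function.Injective e) (hf : Function.Injective f)
    (hef : ∀ j k, e (Fin.succ j) ≠ f k) :
    ∫ ω, W (fun k => X (e k) ω) * W (fun k => X (f k) ω) ∂μ = 0 := by
  have hm {ι : Type} (a : ι → ℕ) : Measurable fun ω (k : ι) => X (a k) ω :=
    measurable_pi_lambda _ fun k => hmeas (a k)
  have hL {a : Fin (m + 1) → ℕ} (ha : Function.Injective a) :
      MemLp (fun ω => W (fun k => X (a k) ω)) 2 μ := by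
    rw [← map_comp_eq_pi hmeas hindep hident ha] at hW2
    exact hW2.comp_of_map (hm a).aemeasurable
  -- `none` carries `e 0`, which may also occur in `f`. So `a` need not be injective; only its
  -- disjointness from the tail of `e` and the marginal law at `none` are used.
  let a : Option (Fin (m + 1)) → ℕ := fun o => o.elim (e 0) f
  have hind : IndepFun (fun ω o => X (a o) ω) (fun ω j => X (e (Fin.succ j)) ω) μ := by
    refine indepFun_comp_comp hmeas hindep ?_
    rintro (_ | k) j
    · exact fun h => (Fin.succ_ne_zero j) (he h).symm
    · exact (hef j k).symm
  have hcons (ω : Ω) : (fun k => X (e k) ω) =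
      Fin.cons (X (a none) ω) fun j => X (e (Fin.succ j)) ω := by
    funext k
    refine Fin.cases rfl (fun j => rfl) k
  have hc : Measurable fun p : (Option (Fin (m + 1)) → ℝ) × (Fin m → ℝ) =>
      (Fin.cons (p.1 none) p.2 : Fin (m + 1) → ℝ) :=
    ((measurable_pi_apply none).comp measurable_fst).finCons measurable_snd
  have key := hind.integral_mul_eq_zero (hm a) (hm fun j => e (Fin.succ j))
    (φ := fun p => W (Fin.cons (p.1 none) p.2)) (ψ := fun y => W fun k => y (some k))
    (hW.comp hc)
    (hW.comp (measurable_pi_lambda _ fun k => measurable_pi_apply _))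
    (by simpa only [hcons] using! (hL he).integrable_mul (hL hf))
    (by
      rw [map_comp_eq_pi hmeas hindep hident (e := fun j => e (Fin.succ j))
        (he.comp (Fin.succ_injective m))]
      have h : (μ.map fun ω o => X (a o) ω).map (fun y => y none) = μ.map (X 0) := by
        rw [Measure.map_map (measurable_pi_apply _) (hm a)]
        exact (hident (e 0)).map_eq
      exact ae_of_ae_map (f := fun y : Option (Fin (m + 1)) → ℝ => y none)
        (measurable_pi_apply none).aemeasurable (by rw [h]; exact hW0))
  simpa only [hcons] using! key

end IID

theorem tendstoInMeasure_zero_of_tendsto_integral_sq {Ω : Type*} [MeasurableSpace Ω]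
    {μ : Measure Ω} {f : ℕ → Ω → ℝ} (hf : ∀ n, MemLp (f n) 2 μ)
    (h : Tendsto (fun n => ∫ ω, f n ω ^ 2 ∂μ) atTop (nhds 0)) :
    TendstoInMeasure μ f atTop 0 := by
  refine tendstoInMeasure_of_tendsto_eLpNorm (p := 2) two_ne_zero
    (fun n => (hf n).aestronglyMeasurable) aestronglyMeasurable_const ?_
  simp only [sub_zero]
  have h2 (n : ℕ) : eLpNorm (f n) 2 μ = ENNReal.ofReal (√(∫ ω, f n ω ^ 2 ∂μ)) := by
    rw [(hf n).eLpNorm_eq_integral_rpow_norm two_ne_zero ENNReal.ofNat_ne_top, Real.sqrt_eq_rpow]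
    simp
  simp only [h2]
  simpa using ENNReal.tendsto_ofReal (h.sqrt)

theorem measurePreserving_finCons (P : Measure ℝ) [IsProbabilityMeasure P] (m : ℕ) :
    MeasurePreserving (fun p : ℝ × (Fin m → ℝ) => (Fin.cons p.1 p.2 : Fin (m + 1) → ℝ))
      (P.prod (Measure.pi fun _ => P)) (Measure.pi fun _ => P) := by
  have h := (measurePreserving_piFinSuccAbove (fun _ : Fin (m + 1) => P) 0).symm
  have he : (fun p : ℝ × (Fin m → ℝ) => (Fin.cons p.1 p.2 : Fin (m + 1) → ℝ)) =
      (MeasurableEquiv.piFinSuccAbove (fun _ : Fin (m + 1) => ℝ) 0).symm := by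
    funext p
    simp [MeasurableEquiv.piFinSuccAbove]
    rfl
  rw [he]
  exact h

/-- Position `0` is reserved for the index that two sets may share: it is the argument held fixed
when the other arguments of the kernel are integrated out. -/
theorem Finset.exists_fin_enumeration {α : Type*} [DecidableEq α] {s : Finset α} {m : ℕ}
    (hs : s.card = m + 1) {i : α} (hi : i ∈ s) :
    ∃ e : Fin (m + 1) → α, Function.Injective e ∧ Finset.univ.image e = s ∧ e 0 = i := by
  let E := s.equivFinOfCardEq hs
  let F := (Equiv.swap 0 (E ⟨i, hi⟩)).trans E.symm
  refine ⟨fun k => F k, Subtype.val_injective.comp F.injective, ?_, by simp [F]⟩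
  ext a
  simp only [Finset.mem_image, Finset.mem_univ, true_and]
  exact ⟨fun ⟨k, hk⟩ => hk ▸ (F k).2, fun ha => ⟨F.symm ⟨a, ha⟩, by simp⟩⟩

/-- The conditional expectation given `X` of a function of two independent variables `X` and `Y`
is obtained by integrating out `Y`. -/
theorem ProbabilityTheory.IndepFun.condExp_comp_prodMk {Ω α β : Type*} [MeasurableSpace Ω]
    [mα : MeasurableSpace α] [MeasurableSpace β] [StandardBorelSpace β] [Nonempty β]
    {μ : Measure Ω} [IsProbabilityMeasure μ] {X : Ω → α} {Y : Ω → β} (h : IndepFun X Y μ)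
    (hX : Measurable X) (hY : Measurable Y) {f : α × β → ℝ} (hf : Measurable f)
    (hint : Integrable (fun ω => f (X ω, Y ω)) μ) :
    μ[fun ω => f (X ω, Y ω) | mα.comap X] =ᵐ[μ] fun ω => ∫ y, f (X ω, y) ∂μ.map Y := by
  have := Measure.isProbabilityMeasure_map (μ := μ) hY.aemeasurable
  refine (condExp_prod_ae_eq_integral_condDistrib hX hY.aemeasurable hf.stronglyMeasurable
    hint).trans ?_
  -- Under independence the joint law is a product, which the constant kernel disintegrates.
  have hk : condDistrib Y X μ =ᵐ[μ.map X] Kernel.const α (μ.map Y) := by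
    refine condDistrib_ae_eq_of_measure_eq_compProd X hY.aemeasurable ?_
    rw [(indepFun_iff_map_prod_eq_prod_map_map hX.aemeasurable hY.aemeasurable).1 h,
      Measure.compProd_const]
  filter_upwards [ae_of_ae_map hX.aemeasurable hk] with ω hω
  rw [hω, Kernel.const_apply]

/-! ### Hoeffding projection of a kernel -/

/-- The first projection `x ↦ E h(x, X₂, …, Xᵥ)` of a kernel. -/
noncomputable def kernelProjection (P : Measure ℝ) {m : ℕ} (h : (Fin (m + 1) → ℝ) → ℝ) (x : ℝ) :
    ℝ :=
  ∫ z : Fin m → ℝ, h (Fin.cons x z) ∂Measure.pi fun _ => P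

theorem measurable_kernelProjection (P : Measure ℝ) [IsProbabilityMeasure P] {m : ℕ}
    {h : (Fin (m + 1) → ℝ) → ℝ} (hh : Measurable h) : Measurable (kernelProjection P h) :=
  (StronglyMeasurable.integral_prod_right'
    (hh.comp (measurable_fst.finCons measurable_snd)).stronglyMeasurable).measurable

section IID

variable {Ω : Type*} [MeasurableSpace Ω] {μ : Measure Ω} [IsProbabilityMeasure μ] {X : ℕ → Ω → ℝ}

theorem condExp_comp_ae_eq_kernelProjection (hmeas : ∀ i, Measurable (X i))
    (hindep : iIndepFun X μ) (hident : ∀ i, IdentDistrib (X i) (X 0) μ μ) {m : ℕ}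
    {h : (Fin (m + 1) → ℝ) → ℝ} (hh : Measurable h)
    (hint : Integrable (fun ω => h fun k => X k ω) μ) :
    μ[fun ω => h fun k => X k ω | MeasurableSpace.comap (X 0) inferInstance]
      =ᵐ[μ] fun ω => kernelProjection (μ.map (X 0)) h (X 0 ω) := by
  have hcons (ω : Ω) : (fun k : Fin (m + 1) => X k ω) =
      Fin.cons (X 0 ω) fun j : Fin m => X (j + 1) ω := by
    funext k
    refine Fin.cases rfl (fun j => by simp) k
  have hind : IndepFun (X 0) (fun ω (j : Fin m) => X (j + 1) ω) μ :=
    (indepFun_comp_comp hmeas hindep (e := fun _ : Unit => 0) (f := fun j : Fin m => (j : ℕ) + 1)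
      (by simp)).comp (measurable_pi_apply ()) measurable_id
  have hY : Measurable fun ω (j : Fin m) => X (j + 1) ω := measurable_pi_lambda _ fun _ => hmeas _
  simp only [hcons] at hint ⊢
  have := hind.condExp_comp_prodMk (hmeas 0) hY (hh.comp (measurable_fst.finCons measurable_snd)) hint
  rw [map_comp_eq_pi hmeas hindep hident (e := fun j : Fin m => (j : ℕ) + 1)
    (fun i j hij => Fin.ext (by simpa using hij))] at this
  exact this

/-- Evaluated at `X 0`, the projection is a conditional expectation, and these preserve L². -/
theorem memLp_kernelProjection (hmeas : ∀ i, Measurable (X i))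
    (hindep : iIndepFun X μ) (hident : ∀ i, IdentDistrib (X i) (X 0) μ μ) {m : ℕ}
    {h : (Fin (m + 1) → ℝ) → ℝ} (hh : Measurable h)
    (hL : MemLp h 2 (Measure.pi fun _ => μ.map (X 0))) :
    MemLp (kernelProjection (μ.map (X 0)) h) 2 (μ.map (X 0)) := by
  have := Measure.isProbabilityMeasure_map (μ := μ) (hmeas 0).aemeasurable
  rw [← map_comp_eq_pi hmeas hindep hident (e := fun k : Fin (m + 1) => (k : ℕ))
    Fin.val_injective] at hL
  have hL' := hL.comp_of_map (measurable_pi_lambda _ fun _ => hmeas _).aemeasurable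
  have h2 := (memLp_congr_ae (condExp_comp_ae_eq_kernelProjection hmeas hindep hident hh
    (hL'.integrable one_le_two))).1 (hL'.condExp one_le_two)
  exact (memLp_map_measure_iff (measurable_kernelProjection _ hh).aestronglyMeasurable
    (hmeas 0).aemeasurable).2 h2

end IID

theorem integral_kernelProjection {P : Measure ℝ} [IsProbabilityMeasure P] {m : ℕ}
    {h : (Fin (m + 1) → ℝ) → ℝ} (hh : Measurable h)
    (hint : Integrable h (Measure.pi fun _ => P)) :
    ∫ x, kernelProjection P h x ∂P = ∫ x, h x ∂Measure.pi fun _ => P := by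
  have hp := measurePreserving_finCons P m
  rw [← hp.map_eq, integral_map hp.measurable.aemeasurable hh.aestronglyMeasurable,
    integral_prod (fun p : ℝ × (Fin m → ℝ) => h (Fin.cons p.1 p.2))
      (hp.integrable_comp_of_integrable hint)]
  rfl

/-- The kernel minus its first order Hoeffding projection. -/
noncomputable def degenerateKernel (P : Measure ℝ) {m : ℕ} (h : (Fin (m + 1) → ℝ) → ℝ)
    (x : Fin (m + 1) → ℝ) : ℝ :=
  h x - (∫ y, h y ∂Measure.pi fun _ => P)
    - ∑ k, (kernelProjection P h (x k) - ∫ y, h y ∂Measure.pi fun _ => P)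

theorem measurable_degenerateKernel (P : Measure ℝ) [IsProbabilityMeasure P] {m : ℕ}
    {h : (Fin (m + 1) → ℝ) → ℝ} (hh : Measurable h) : Measurable (degenerateKernel P h) := by
  have := measurable_kernelProjection P hh
  unfold degenerateKernel
  fun_prop

theorem memLp_degenerateKernel {P : Measure ℝ} [IsProbabilityMeasure P] {m : ℕ}
    {h : (Fin (m + 1) → ℝ) → ℝ} (hL : MemLp h 2 (Measure.pi fun _ => P))
    (hg : MemLp (kernelProjection P h) 2 P) :
    MemLp (degenerateKernel P h) 2 (Measure.pi fun _ => P) :=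
  (hL.sub (memLp_const _)).sub (memLp_finsetSum _ fun k _ =>
    (hg.comp_measurePreserving (measurePreserving_eval (fun _ => P) k)).sub (memLp_const _))

/-- Integrating out the tail turns h - N into g(x) - N, which the first summand cancels; the other
summands have mean zero. The exceptional null set is where the section of `h` may fail to be
integrable. -/
theorem kernelProjection_degenerateKernel {P : Measure ℝ} [IsProbabilityMeasure P] {m : ℕ}
    {h : (Fin (m + 1) → ℝ) → ℝ} (hh : Measurable h)
    (hint : Integrable h (Measure.pi fun _ => P)) (hg : Integrable (kernelProjection P h) P) :
    ∀ᵐ x ∂P, kernelProjection P (degenerateKernel P h) x = 0 := by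
  have hp := measurePreserving_finCons P m
  filter_upwards [(hp.integrable_comp_of_integrable hint).prod_right_ae] with x hx
  set N := ∫ y, h y ∂Measure.pi fun _ : Fin (m + 1) => P with hN
  have hgj (j : Fin m) : Integrable (fun z : Fin m → ℝ => kernelProjection P h (z j) - N)
      (Measure.pi fun _ => P) :=
    (integrable_comp_eval (μ := fun _ : Fin m => P) (i := j) hg).sub (integrable_const _)
  have hx' : Integrable (fun z : Fin m → ℝ => h (Fin.cons x z)) (Measure.pi fun _ => P) := hx
  have h0 (j : Fin m) : ∫ z : Fin m → ℝ, (kernelProjection P h (z j) - N)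
      ∂Measure.pi (fun _ => P) = 0 := by
    rw [integral_sub (integrable_comp_eval (μ := fun _ : Fin m => P) (i := j) hg)
      (integrable_const _), integral_comp_eval (μ := fun _ : Fin m => P) (i := j)
      hg.aestronglyMeasurable, integral_kernelProjection hh hint]
    simp [hN]
  rw [kernelProjection]
  simp only [degenerateKernel, Fin.sum_univ_succ, Fin.cons_zero, Fin.cons_succ, ← hN]
  have hsum : Integrable (fun z : Fin m → ℝ => ∑ j, (kernelProjection P h (z j) - N))
      (Measure.pi fun _ => P) := integrable_finsetSum _ fun j _ => hgj j
  have h1 : Integrable (fun z : Fin m → ℝ => h (Fin.cons x z) - N) (Measure.pi fun _ => P) :=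
    hx'.sub (integrable_const N)
  have h2 : Integrable (fun z : Fin m → ℝ => kernelProjection P h x - N +
      ∑ j, (kernelProjection P h (z j) - N)) (Measure.pi fun _ => P) :=
    (integrable_const _).add hsum
  rw [integral_sub h1 h2, integral_sub hx' (integrable_const _),
    integral_add (integrable_const _) hsum, integral_finsetSum _ fun j _ => hgj j]
  simp only [h0]
  simp [kernelProjection]

/-! ### Central limit theorem for U-statistics -/

open Finset in
/-- **Central limit theorem for U-statistics** with a square integrable kernel `h` of degree
`m + 1`. Here `K s` is the value of the kernel on the variables indexed by `s`, which does not
depend on the order in which `s` is enumerated. -/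
theorem tendstoInDistribution_uStat {Ω : Type*} [MeasurableSpace Ω] {μ : Measure Ω}
    [IsProbabilityMeasure μ] {X : ℕ → Ω → ℝ} (hmeas : ∀ i, Measurable (X i))
    (hindep : iIndepFun X μ) (hident : ∀ i, IdentDistrib (X i) (X 0) μ μ) {m : ℕ}
    {h : (Fin (m + 1) → ℝ) → ℝ} (hh : Measurable h)
    (hL : MemLp h 2 (Measure.pi fun _ => μ.map (X 0))) {K : Finset ℕ → Ω → ℝ}
    (hK : ∀ e : Fin (m + 1) → ℕ, Function.Injective e →
      K (univ.image e) = fun ω => h fun k => X (e k) ω) :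
    TendstoInDistribution
      (fun (n : ℕ) ω => √(n : ℝ) * (((n.choose (m + 1) : ℕ) : ℝ)⁻¹ *
        ∑ s ∈ (range n).powersetCard (m + 1), K s ω - ∫ x, h x ∂Measure.pi fun _ => μ.map (X 0)))
      atTop (id : ℝ → ℝ) (fun _ => μ)
      (gaussianReal 0 (((m + 1 : ℕ) : ℝ) ^ 2 *
        Var[fun ω => kernelProjection (μ.map (X 0)) h (X 0 ω); μ]).toNNReal) := by
  have hP := Measure.isProbabilityMeasure_map (μ := μ) (hmeas 0).aemeasurable
  set P := μ.map (X 0) with hPdef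
  set N := ∫ x, h x ∂Measure.pi fun _ => P with hN
  set g := kernelProjection P h with hgdef
  have hint : Integrable h (Measure.pi fun _ => P) := hL.integrable one_le_two
  have hgm : Measurable g := measurable_kernelProjection P hh
  have hg : MemLp g 2 P := memLp_kernelProjection hmeas hindep hident hh hL
  have hgX : MemLp (fun ω => g (X 0 ω)) 2 μ := hg.comp_of_map (hmeas 0).aemeasurable
  have hgN : ∫ ω, g (X 0 ω) ∂μ = N := by
    rw [← integral_map (hmeas 0).aemeasurable hgm.aestronglyMeasurable]
    exact integral_kernelProjection hh hint
  let W : Finset ℕ → Ω → ℝ := fun s ω => K s ω - N - ∑ i ∈ s, (g (X i ω) - N)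
  have hW {e : Fin (m + 1) → ℕ} (he : Function.Injective e) :
      W (univ.image e) = fun ω => degenerateKernel P h fun k => X (e k) ω := by
    funext ω
    simp only [W, hK e he, degenerateKernel, ← hN, ← hgdef]
    rw [sum_image he.injOn]
  have hWexists {s : Finset ℕ} (hs : #s = m + 1) : ∃ e : Fin (m + 1) → ℕ,
      Function.Injective e ∧ univ.image e = s := by
    obtain ⟨i, hi⟩ := card_pos.1 (by omega : 0 < #s)
    obtain ⟨e, he, hes, -⟩ := exists_fin_enumeration hs hi
    exact ⟨e, he, hes⟩
  have hD := memLp_degenerateKernel hL hg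
  have hDm := measurable_degenerateKernel P hh
  have hXm (e : Fin (m + 1) → ℕ) : Measurable fun ω k => X (e k) ω :=
    measurable_pi_lambda _ fun k => hmeas (e k)
  have hW2 (s : Finset ℕ) (hs : #s = m + 1) : MemLp (W s) 2 μ := by
    obtain ⟨e, he, rfl⟩ := hWexists hs
    rw [hW he]
    rw [← map_comp_eq_pi hmeas hindep hident he] at hD
    exact hD.comp_of_map (hXm e).aemeasurable
  have hWC (s : Finset ℕ) (hs : #s = m + 1) :
      ∫ ω, W s ω ^ 2 ∂μ ≤ ∫ x, degenerateKernel P h x ^ 2 ∂Measure.pi fun _ => P := by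
    obtain ⟨e, he, rfl⟩ := hWexists hs
    rw [hW he, ← map_comp_eq_pi hmeas hindep hident he,
      integral_map (hXm e).aemeasurable (hDm.pow_const 2).aestronglyMeasurable]
  have hW0 (s t : Finset ℕ) (hs : #s = m + 1) (ht : #t = m + 1) (hst : #(s ∩ t) ≤ 1) :
      ∫ ω, W s ω * W t ω ∂μ = 0 := by
    -- `i` is the common index if there is one, and any element of `s` otherwise.
    obtain ⟨i, hi, hit⟩ : ∃ i ∈ s, ∀ j ∈ s, j ∈ t → j = i := by
      obtain h0 | ⟨i, hi⟩ := (s ∩ t).eq_empty_or_nonempty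
      · obtain ⟨i, hi⟩ := card_pos.1 (by omega : 0 < #s)
        exact ⟨i, hi, fun j hj hjt => absurd (mem_inter.2 ⟨hj, hjt⟩) (h0 ▸ notMem_empty j)⟩
      · exact ⟨i, (mem_inter.1 hi).1, fun j hj hjt =>
          card_le_one.1 hst j (mem_inter.2 ⟨hj, hjt⟩) i hi⟩
    obtain ⟨e, he, rfl, he0⟩ := exists_fin_enumeration hs hi
    obtain ⟨f, hf, rfl⟩ := hWexists ht
    rw [hW he, hW hf]
    refine integral_degenerate_mul_eq_zero hmeas hindep hident hDm hD
      (kernelProjection_degenerateKernel hh hint (hg.integrable one_le_two)) he hf ?_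
    intro j k hjk
    have := hit (e j.succ) (mem_image_of_mem e (mem_univ _)) (hjk ▸ mem_image_of_mem f (mem_univ k))
    exact Fin.succ_ne_zero j (he (this.trans he0.symm))
  set C := ∫ x, degenerateKernel P h x ^ 2 ∂Measure.pi fun _ => P
  let R : ℕ → Ω → ℝ := fun n ω => √(n : ℝ) * (((n.choose (m + 1) : ℕ) : ℝ)⁻¹ *
    ∑ s ∈ (range n).powersetCard (m + 1), W s ω)
  have hR2 (n : ℕ) : MemLp (R n) 2 μ :=
    ((memLp_finsetSum _ fun s hs => hW2 s (mem_powersetCard.1 hs).2).const_mul _).const_mul _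
  have hR : TendstoInMeasure μ R atTop 0 := by
    refine tendstoInMeasure_zero_of_tendsto_integral_sq hR2 ?_
    have hlim := (tendsto_mul_choose_two_mul_choose_div_choose (m + 1)).mul_const C
    rw [zero_mul] at hlim
    refine squeeze_zero (fun n => integral_nonneg fun ω => sq_nonneg _) (fun n => ?_) hlim
    simp only [R, mul_pow, Real.sq_sqrt (Nat.cast_nonneg n), integral_const_mul]
    rw [mul_assoc]
    refine mul_le_mul_of_nonneg_left ?_ (Nat.cast_nonneg n)
    refine (mul_le_mul_of_nonneg_left (integral_sq_sum_powersetCard_le hW2 hWC hW0 n)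
      (sq_nonneg _)).trans_eq ?_
    by_cases hc : ((n.choose (m + 1) : ℕ) : ℝ) = 0
    · simp [hc]
    · field_simp
  -- The factor `m + 1` appears because each index lies in a fraction (m+1)/n of the subsets.
  have hclt := tendstoInDistribution_inv_sqrt_mul_sum_sub (P := μ) (Y := id)
    (X := fun i ω => ((m + 1 : ℕ) : ℝ) * g (X i ω))
    (P' := gaussianReal 0 (Var[fun ω => ((m + 1 : ℕ) : ℝ) * g (X 0 ω); μ]).toNNReal)
    ⟨aemeasurable_id, Measure.map_id⟩ (hgX.const_mul _)
    (hindep.comp (fun _ x => ((m + 1 : ℕ) : ℝ) * g x) fun _ => hgm.const_mul _)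
    (fun i => (hident i).comp (u := fun x => ((m + 1 : ℕ) : ℝ) * g x) (hgm.const_mul _))
  rw [variance_const_mul] at hclt
  refine tendstoInDistribution_of_tendstoInMeasure_sub _ _ hclt ?_ ?_
  · refine hR.congr' ?_ (EventuallyEq.refl _ _)
    -- For smaller `n` the binomial coefficient is zero and the decomposition breaks down.
    filter_upwards [eventually_ge_atTop (m + 1)] with n hn
    refine Eventually.of_forall fun ω => ?_
    have hn0 : (n : ℝ) ≠ 0 := Nat.cast_ne_zero.2 (by omega)
    have hc : ((n.choose (m + 1) : ℕ) : ℝ) ≠ 0 := Nat.cast_ne_zero.2 (Nat.choose_pos hn).ne'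
    have hr : √(n : ℝ) * √(n : ℝ) = n := Real.mul_self_sqrt (Nat.cast_nonneg n)
    have hr0 : √(n : ℝ) ≠ 0 := fun h0 => hn0 (by rw [← hr, h0, zero_mul])
    have hch := Nat.cast_choose_succ_mul n m
    simp only [R, W, Pi.sub_apply, integral_const_mul, hgN, ← mul_sum, sum_sub_distrib,
      sum_const, card_powersetCard, card_range, nsmul_eq_mul]
    have hsum := sum_powersetCard_sum (range n) m fun i => g (X i ω) - N
    simp only [sum_sub_distrib, sum_const, card_range, nsmul_eq_mul] at hsum
    rw [hsum]
    have hch' : (((n - 1).choose m : ℕ) : ℝ) = (n.choose (m + 1) : ℕ) * (m + 1) / n := by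
      rw [hch]; field_simp
    rw [hch']
    generalize √(n : ℝ) = r at *
    rw [← hr] at hn0 ⊢
    push_cast
    field_simp
  · intro n
    have hKm : ∀ s ∈ (range n).powersetCard (m + 1), Measurable (K s) := by
      intro s hs
      obtain ⟨e, he, rfl⟩ := hWexists (mem_powersetCard.1 hs).2
      rw [hK e he]
      exact hh.comp (hXm e)
    exact (((measurable_sum _ hKm).const_mul _).sub_const _).const_mul _ |>.aemeasurable

/-! ### Mean of the maximum and of the minimum -/

theorem abs_iSup_le_sum_abs {ι : Type*} [Fintype ι] [Nonempty ι] (w : ι → ℝ) :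
    |⨆ i, w i| ≤ ∑ i, |w i| := by
  obtain ⟨j, hj⟩ := exists_eq_ciSup_of_finite (f := w)
  rw [← hj]
  exact Finset.single_le_sum (f := fun i => |w i|) (fun i _ => abs_nonneg _) (Finset.mem_univ j)

theorem MeasureTheory.MemLp.iSup {α ι : Type*} [MeasurableSpace α] {ν : Measure α} [Fintype ι]
    [Nonempty ι] {p : ENNReal} {w : ι → α → ℝ} (hw : ∀ i, MemLp (w i) p ν) :
    MemLp (fun a => ⨆ i, w i a) p ν := by
  refine (memLp_finsetSum Finset.univ fun i _ => (hw i).norm).mono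
    (AEMeasurable.iSup fun i => (hw i).aestronglyMeasurable.aemeasurable).aestronglyMeasurable ?_
  refine Eventually.of_forall fun a => ?_
  refine (abs_iSup_le_sum_abs fun i => w i a).trans ?_
  exact le_abs_self _

theorem MeasureTheory.Integrable.iSup {α ι : Type*} [MeasurableSpace α] {ν : Measure α} [Fintype ι]
    [Nonempty ι] {w : ι → α → ℝ} (hw : ∀ i, Integrable (w i) ν) :
    Integrable (fun a => ⨆ i, w i a) ν :=
  memLp_one_iff_integrable.1 (MemLp.iSup fun i => memLp_one_iff_integrable.2 (hw i))

theorem iSup_fin_succ {m : ℕ} (w : Fin (m + 2) → ℝ) :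
    ⨆ i, w i = max (w 0) (⨆ i, w (Fin.succ i)) := by
  refine le_antisymm (ciSup_le fun i => ?_) (max_le (le_ciSup (Set.finite_range w).bddAbove 0)
    (ciSup_le fun i => le_ciSup (Set.finite_range w).bddAbove _))
  cases i using Fin.cases with
  | zero => exact le_max_left _ _
  | succ j =>
    exact le_max_of_le_right
      (le_ciSup (f := fun i => w (Fin.succ i)) (Set.finite_range _).bddAbove j)

/-- Absorbing one variable into the fixed argument drives the induction in `integral_iSup_finCons`.
-/
theorem iSup_finCons_finCons {m : ℕ} (x y : ℝ) (z : Fin m → ℝ) :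
    ⨆ i, (Fin.cons x (Fin.cons y z : Fin (m + 1) → ℝ) : Fin (m + 2) → ℝ) i =
      ⨆ i, (Fin.cons (max x y) z : Fin (m + 1) → ℝ) i := by
  rw [iSup_fin_succ]
  simp only [Fin.cons_zero, Fin.cons_succ]
  cases m with
  | zero => simp
  | succ m => simp only [iSup_fin_succ, Fin.cons_zero, Fin.cons_succ, max_assoc]

theorem integrable_mul_cdf_pow {P : Measure ℝ} (hP : Integrable (fun x : ℝ => x) P) (k : ℕ) :
    Integrable (fun y => y * cdf P y ^ k) P :=
  hP.mul_bdd (c := 1) (((monotone_cdf P).measurable.pow_const k).aestronglyMeasurable)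
    (Eventually.of_forall fun y => by
      rw [Real.norm_of_nonneg (pow_nonneg (cdf_nonneg P y) k)]
      exact pow_le_one₀ (cdf_nonneg P y) (cdf_le_one P y))

section Tail

variable {P : Measure ℝ} [IsProbabilityMeasure P] {φ : ℝ → ℝ}

theorem integrable_indicator_lt (hφ : Integrable φ P) :
    Integrable (fun p : ℝ × ℝ => {p : ℝ × ℝ | p.1 < p.2}.indicator (fun p => φ p.2) p)
      (P.prod P) :=
  (hφ.comp_snd P).indicator (measurableSet_lt measurable_fst measurable_snd)

theorem integrable_setIntegral_Ioi (hφ : Integrable φ P) :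
    Integrable (fun y => ∫ z in Set.Ioi y, φ z ∂P) P := by
  refine (integrable_indicator_lt hφ).integral_prod_left.congr (Eventually.of_forall fun y => ?_)
  exact integral_indicator (μ := P) measurableSet_Ioi

/-- Fubini on x < y < z: for fixed z, the y-section is `Ioo x z`, of mass F(z) - F(x) as there are
no atoms. -/
theorem setIntegral_Ioi_setIntegral_Ioi [NullSingletonClass P] (hφ : Integrable φ P) (x : ℝ) :
    ∫ y in Set.Ioi x, ∫ z in Set.Ioi y, φ z ∂P ∂P =
      ∫ z in Set.Ioi x, (cdf P z - cdf P x) * φ z ∂P := by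
  have hs : MeasurableSet {p : ℝ × ℝ | x < p.1 ∧ p.1 < p.2} :=
    (measurableSet_lt measurable_const measurable_fst).inter
      (measurableSet_lt measurable_fst measurable_snd)
  have hi : Integrable
      (Function.uncurry fun y z => {p : ℝ × ℝ | x < p.1 ∧ p.1 < p.2}.indicator (fun p => φ p.2) (y, z))
      (P.prod P) := (hφ.comp_snd P).indicator hs
  have hl : ∫ y in Set.Ioi x, ∫ z in Set.Ioi y, φ z ∂P ∂P = ∫ y, ∫ z,
      {p : ℝ × ℝ | x < p.1 ∧ p.1 < p.2}.indicator (fun p => φ p.2) (y, z) ∂P ∂P := by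
    rw [← integral_indicator measurableSet_Ioi]
    congr 1
    funext y
    by_cases hy : x < y
    · rw [Set.indicator_of_mem (Set.mem_Ioi.2 hy), ← integral_indicator measurableSet_Ioi]
      congr 1
      funext z
      simp [Set.indicator_apply, hy]
    · rw [Set.indicator_of_notMem (by simpa using hy)]
      simp [hy]
  rw [hl, integral_integral_swap hi, ← integral_indicator measurableSet_Ioi]
  congr 1
  funext z
  have hz : ∀ y, {p : ℝ × ℝ | x < p.1 ∧ p.1 < p.2}.indicator (fun p => φ p.2) (y, z) =
      (Set.Ioo x z).indicator (fun _ => φ z) y := fun y => by simp [Set.indicator_apply]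
  simp only [hz]
  rw [integral_indicator measurableSet_Ioo, setIntegral_const, smul_eq_mul]
  by_cases hxz : x < z
  · rw [Set.indicator_of_mem (Set.mem_Ioi.2 hxz), cdf_eq_real, cdf_eq_real]
    congr 1
    rw [measureReal_congr Ioo_ae_eq_Ioc,
      show Set.Ioc x z = Set.Iic z \ Set.Iic x by ext; simp [and_comm],
      measureReal_sdiff (Set.Iic_subset_Iic.2 hxz.le) measurableSet_Iic]
  · rw [Set.indicator_of_notMem (by simpa using hxz), Set.Ioo_eq_empty hxz]
    simp

end Tail

/-- The mean of the maximum of `x` and of `m` independent variables with a continuous law. -/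
theorem integral_iSup_finCons {P : Measure ℝ} [IsProbabilityMeasure P] [NullSingletonClass P]
    (hP : Integrable (fun x : ℝ => x) P) (m : ℕ) (x : ℝ) :
    ∫ z : Fin m → ℝ, ⨆ i, (Fin.cons x z : Fin (m + 1) → ℝ) i ∂Measure.pi (fun _ => P) =
      x * cdf P x ^ m + m * ∫ y in Set.Ioi x, y * cdf P y ^ (m - 1) ∂P := by
  induction m generalizing x with
  | zero => simp
  | succ m ih =>
    have hp := measurePreserving_finCons P m
    have hm : Measurable fun z : Fin (m + 1) → ℝ =>
        ⨆ i, (Fin.cons x z : Fin (m + 2) → ℝ) i :=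
      Measurable.iSup fun i => (measurable_pi_apply i).comp
        (measurable_const.finCons measurable_id)
    rw [← hp.map_eq, integral_map hp.measurable.aemeasurable hm.aestronglyMeasurable]
    simp only [iSup_finCons_finCons]
    have hint : Integrable (fun p : ℝ × (Fin m → ℝ) =>
        ⨆ i, (Fin.cons (max x p.1) p.2 : Fin (m + 1) → ℝ) i)
        (P.prod (Measure.pi fun _ => P)) := by
      refine Integrable.iSup (w := fun i (p : ℝ × (Fin m → ℝ)) =>
        (Fin.cons (max x p.1) p.2 : Fin (m + 1) → ℝ) i) fun i => ?_
      cases i using Fin.cases with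
      | zero =>
        simp only [Fin.cons_zero]
        exact ((integrable_const x).sup hP).comp_fst _
      | succ j =>
        simp only [Fin.cons_succ]
        exact (integrable_comp_eval (μ := fun _ : Fin m => P) (i := j) hP).comp_snd P
    rw [integral_prod _ hint]
    simp only [ih]
    set φ : ℝ → ℝ := fun y => y * cdf P y ^ (m - 1) with hφ
    have hφi : Integrable φ P := integrable_mul_cdf_pow hP _
    have hAmax := hint.integral_prod_left
    simp only [ih] at hAmax
    -- With A_m(x) the formula for m variables, A_{m+1}(x) = E A_m(max(x, X)). The part X ≤ x gives
    -- F(x)·A_m(x); its tail integral cancels against the F(x) term of the double integral over X >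
    -- x.
    rw [← integral_add_compl (measurableSet_Iic (a := x)) hAmax, Set.compl_Iic]
    have hle : ∫ y in Set.Iic x, (max x y * cdf P (max x y) ^ m +
        m * ∫ z in Set.Ioi (max x y), φ z ∂P) ∂P =
        ∫ _ in Set.Iic x, (x * cdf P x ^ m + m * ∫ z in Set.Ioi x, φ z ∂P) ∂P :=
      setIntegral_congr_fun measurableSet_Iic fun y hy => by
        simp only [max_eq_left (Set.mem_Iic.1 hy)]
    have hlt : ∫ y in Set.Ioi x, (max x y * cdf P (max x y) ^ m +
        m * ∫ z in Set.Ioi (max x y), φ z ∂P) ∂P =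
        ∫ y in Set.Ioi x, (y * cdf P y ^ m + m * ∫ z in Set.Ioi y, φ z ∂P) ∂P :=
      setIntegral_congr_fun measurableSet_Ioi fun y hy => by
        simp only [max_eq_right (Set.mem_Ioi.1 hy).le]
    rw [hle, hlt, setIntegral_const, smul_eq_mul, ← cdf_eq_real,
      integral_add (integrable_mul_cdf_pow hP m).integrableOn
        ((integrable_setIntegral_Ioi hφi).const_mul _).integrableOn, integral_const_mul,
      setIntegral_Ioi_setIntegral_Ioi hφi]
    have hφF : Integrable (fun z => cdf P z * φ z) P := by
      refine (integrable_mul_cdf_pow hP (m - 1 + 1)).congr (Eventually.of_forall fun z => ?_)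
      simp only [hφ, pow_succ]
      ring
    simp only [sub_mul]
    rw [integral_sub hφF.integrableOn (hφi.const_mul _).integrableOn, integral_const_mul]
    -- For `m = 0` the exponent `m - 1` truncates and the integrands differ, but the factor `m`
    -- vanishes.
    have hpow : (m : ℝ) * ∫ z in Set.Ioi x, cdf P z * φ z ∂P =
        m * ∫ z in Set.Ioi x, z * cdf P z ^ m ∂P := by
      cases m with
      | zero => simp
      | succ k =>
        congr 2
        funext z
        simp only [hφ, Nat.add_sub_cancel, pow_succ]
        ring
    push_cast
    linear_combination hpow

/-- No boundedness is needed: the real `sInf` is defined by reflecting `sSup`. -/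
theorem Real.iInf_eq_neg_iSup_neg {ι : Type*} (w : ι → ℝ) : ⨅ i, w i = -⨆ i, -w i := by
  rw [iInf, Real.sInf_def, iSup, Set.neg_range]

/-- The mean of the minimum of `x` and of `m` independent variables with a continuous law. -/
theorem integral_iInf_finCons {P : Measure ℝ} [IsProbabilityMeasure P] [NullSingletonClass P]
    (hP : Integrable (fun x : ℝ => x) P) (m : ℕ) (x : ℝ) :
    ∫ z : Fin m → ℝ, ⨅ i, (Fin.cons x z : Fin (m + 1) → ℝ) i ∂Measure.pi (fun _ => P) =
      x * (1 - cdf P x) ^ m + m * ∫ y in Set.Iio x, y * (1 - cdf P y) ^ (m - 1) ∂P := by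
  -- The minimum is minus the maximum of the negated variables. Without atoms, the reflected law has
  -- distribution function 1 - F(y) at -y.
  set Q := P.map fun y => -y with hQ
  have : IsProbabilityMeasure Q := Measure.isProbabilityMeasure_map measurable_neg.aemeasurable
  have hmp : MeasurePreserving (fun y : ℝ => -y) P Q := ⟨measurable_neg, rfl⟩
  have hQa : NullSingletonClass Q := ⟨fun y => by
    rw [hQ, Measure.map_apply measurable_neg (measurableSet_singleton y)]
    simp⟩
  have hcdf (y : ℝ) : cdf Q (-y) = 1 - cdf P y := by
    rw [cdf_eq_real, cdf_eq_real, hQ, map_measureReal_apply measurable_neg measurableSet_Iic]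
    have : (fun y : ℝ => -y) ⁻¹' Set.Iic (-y) = Set.Ici y := by ext; simp
    rw [this, ← measureReal_congr Ioi_ae_eq_Ici, ← Set.compl_Iic,
      probReal_compl_eq_one_sub measurableSet_Iic]
  have hQi : Integrable (fun x : ℝ => x) Q := by
    refine (integrable_map_measure (f := fun y : ℝ => -y) (g := fun x : ℝ => x)
      measurable_id.aestronglyMeasurable measurable_neg.aemeasurable).2 ?_
    exact hP.neg
  have hpi := measurePreserving_pi (fun _ : Fin m => P) (fun _ => Q) fun _ => hmp
  have hmeas : Measurable fun z : Fin m → ℝ => ⨆ i, (Fin.cons (-x) z : Fin (m + 1) → ℝ) i :=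
    Measurable.iSup fun i => (measurable_pi_apply i).comp (measurable_const.finCons measurable_id)
  have key := integral_iSup_finCons hQi m (-x)
  rw [← hpi.map_eq, integral_map hpi.measurable.aemeasurable hmeas.aestronglyMeasurable, hcdf,
    hQ, setIntegral_map measurableSet_Ioi (by
      have := (monotone_cdf Q).measurable
      exact (measurable_id.mul (this.pow_const _)).aestronglyMeasurable)
      measurable_neg.aemeasurable, ← hQ] at key
  have hpre : (fun y : ℝ => -y) ⁻¹' Set.Ioi (-x) = Set.Iio x := by ext; simp
  simp only [hcdf, hpre, neg_mul, integral_neg] at key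
  have hneg (z : Fin m → ℝ) : ⨅ i, (Fin.cons x z : Fin (m + 1) → ℝ) i =
      -⨆ i, (Fin.cons (-x) fun i => -z i : Fin (m + 1) → ℝ) i := by
    rw [Real.iInf_eq_neg_iSup_neg]
    congr 2
    funext i
    cases i using Fin.cases <;> simp
  simp only [hneg, integral_neg, key]
  ring

/-! ### The range kernel -/

theorem memLp_rangeKernel {α ι : Type} [MeasurableSpace α] {ν : Measure α} [Fintype ι]
    [Nonempty ι] {p : ENNReal} {w : ι → α → ℝ} (hw : ∀ i, MemLp (w i) p ν) :
    MemLp (fun a => rangeKernel fun i => w i a) p ν := by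
  simp only [rangeKernel, Real.iInf_eq_neg_iSup_neg, sub_neg_eq_add]
  exact (MemLp.iSup hw).add (MemLp.iSup fun i => (hw i).neg)

theorem measurable_rangeKernel {ι : Type} [Fintype ι] :
    Measurable (rangeKernel : (ι → ℝ) → ℝ) :=
  (Measurable.iSup fun i => measurable_pi_apply i).sub
    (Measurable.iInf fun i => measurable_pi_apply i)

theorem kernelProjection_rangeKernel {P : Measure ℝ} [IsProbabilityMeasure P] [NullSingletonClass P]
    (hP : Integrable (fun x : ℝ => x) P) (hP0 : ∀ᵐ x ∂P, 0 ≤ x) (m : ℕ) (x : ℝ) :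
    kernelProjection P (rangeKernel : (Fin (m + 1) → ℝ) → ℝ) x = rangeProjection P (m + 1) x := by
  have hcons (i : Fin (m + 1)) :
      Integrable (fun z : Fin m → ℝ => (Fin.cons x z : Fin (m + 1) → ℝ) i)
        (Measure.pi fun _ => P) := by
    cases i using Fin.cases with
    | zero => exact integrable_const x
    | succ j => exact integrable_comp_eval (μ := fun _ : Fin m => P) (i := j) hP
  have hsup : Integrable (fun z : Fin m → ℝ => ⨆ i, (Fin.cons x z : Fin (m + 1) → ℝ) i)
      (Measure.pi fun _ => P) := Integrable.iSup hcons
  have hinf : Integrable (fun z : Fin m → ℝ => ⨅ i, (Fin.cons x z : Fin (m + 1) → ℝ) i)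
      (Measure.pi fun _ => P) := by
    simp only [Real.iInf_eq_neg_iSup_neg]
    exact (Integrable.iSup fun i => (hcons i).neg).neg
  -- Nonnegativity removes the negative half-line; the endpoints 0 and x are null.
  have hset : Set.Iio x =ᵐ[P] Set.Ioc 0 x := by
    filter_upwards [hP0, P.ae_ne 0, P.ae_ne x] with y hy hy0 hyx
    refine propext ⟨fun h => ⟨lt_of_le_of_ne hy hy0.symm, le_of_lt h⟩,
      fun h => lt_of_le_of_ne h.2 hyx⟩
  simp only [kernelProjection, rangeKernel]
  rw [integral_sub hsup hinf, integral_iSup_finCons hP, integral_iInf_finCons hP,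
    setIntegral_congr_set hset, rangeProjection, Nat.add_sub_cancel,
    show m + 1 - 2 = m - 1 by omega]
  push_cast
  ring

theorem theorem3p2 {Ω : Type*} [mΩ : MeasurableSpace Ω] (μ : Measure Ω) [IsProbabilityMeasure μ]
    (X : ℕ → Ω → ℝ) (hmeas : ∀ i, Measurable (X i))
    (hindep : iIndepFun X μ) (hident : ∀ i, IdentDistrib (X i) (X 0) μ μ)
    (hnonneg : ∀ᵐ ω ∂μ, 0 ≤ X 0 ω)
    (hac : μ.map (X 0) ≪ volume)
    (hmom : MemLp (X 0) 2 μ)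
    (v : ℕ) (hv : 1 ≤ v) :
    μ[fun ω => rangeKernel (fun i : Fin v => X i ω) |
        MeasurableSpace.comap (X 0) inferInstance]
      =ᵐ[μ] (fun ω => rangeProjection (μ.map (X 0)) v (X 0 ω)) ∧
    TendstoInDistribution
      (fun (n : ℕ) ω => √(n : ℝ) *
        (rangeUStat v n (fun i => X i ω) - ∫ ω', rangeKernel (fun i : Fin v => X i ω') ∂μ))
      atTop (id : ℝ → ℝ) (fun _ => μ)
      (gaussianReal 0
        ((v : ℝ) ^ 2 * Var[fun ω => rangeProjection (μ.map (X 0)) v (X 0 ω); μ]).toNNReal) := by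
  obtain ⟨m, rfl⟩ : ∃ m, v = m + 1 := ⟨v - 1, by omega⟩
  have hPp := Measure.isProbabilityMeasure_map (μ := μ) (hmeas 0).aemeasurable
  -- Absolute continuity enters only through the absence of atoms.
  have hPa : NullSingletonClass (μ.map (X 0)) := ⟨fun x => hac (measure_singleton x)⟩
  have hP2 : MemLp (fun x : ℝ => x) 2 (μ.map (X 0)) :=
    (memLp_map_measure_iff measurable_id.aestronglyMeasurable (hmeas 0).aemeasurable).2 hmom
  have hP0 : ∀ᵐ x ∂μ.map (X 0), 0 ≤ x :=
    (ae_map_iff (hmeas 0).aemeasurable measurableSet_Ici).2 hnonneg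
  have hproj : (fun ω => kernelProjection (μ.map (X 0))
      (rangeKernel : (Fin (m + 1) → ℝ) → ℝ) (X 0 ω)) =
      fun ω => rangeProjection (μ.map (X 0)) (m + 1) (X 0 ω) :=
    funext fun ω => kernelProjection_rangeKernel (hP2.integrable one_le_two) hP0 m (X 0 ω)
  have hL : MemLp (rangeKernel : (Fin (m + 1) → ℝ) → ℝ) 2 (Measure.pi fun _ => μ.map (X 0)) :=
    memLp_rangeKernel (w := fun i (x : Fin (m + 1) → ℝ) => x i) fun i =>
      hP2.comp_measurePreserving (measurePreserving_eval (fun _ => μ.map (X 0)) i)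
  have hXL : MemLp (fun ω => rangeKernel fun k : Fin (m + 1) => X k ω) 2 μ := by
    rw [← map_comp_eq_pi hmeas hindep hident (e := fun k : Fin (m + 1) => (k : ℕ))
      Fin.val_injective] at hL
    exact hL.comp_of_map (measurable_pi_lambda _ fun _ => hmeas _).aemeasurable
  refine ⟨(condExp_comp_ae_eq_kernelProjection hmeas hindep hident measurable_rangeKernel
    (hXL.integrable one_le_two)).trans (EventuallyEq.of_eq hproj), ?_⟩
  have hclt := tendstoInDistribution_uStat hmeas hindep hident measurable_rangeKernel hL
    (K := fun s ω => rangeKernel fun i : s => X i ω) (by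
      intro e he
      funext ω
      have hsurj : Function.Surjective fun k : Fin (m + 1) =>
          (⟨e k, Finset.mem_image_of_mem e (Finset.mem_univ k)⟩ : Finset.univ.image e) := by
        rintro ⟨a, ha⟩
        obtain ⟨k, -, rfl⟩ := Finset.mem_image.1 ha
        exact ⟨k, rfl⟩
      simp only [rangeKernel]
      rw [← hsurj.iSup_comp, ← hsurj.iInf_comp])
  rw [hproj] at hclt
  rw [← map_comp_eq_pi hmeas hindep hident (e := fun k : Fin (m + 1) => (k : ℕ))
    Fin.val_injective, integral_map (measurable_pi_lambda _ fun _ => hmeas _).aemeasurable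
    measurable_rangeKernel.aestronglyMeasurable] at hclt
  exact hclt
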